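/- A \emph{hypergraph} on a finite set $X$ is a finite nonempty collection $\mathcal H$ of subsets of $X$ (its \emph{edges}), with repeats allowed; $|\mathcal H|$ is the number of edges counted with multiplicity. It is \emph{$\ell$-bounded} if every edge has size at most $\ell$, and \emph{$\kappa$-spread} (for a real $\kappa>0$) if for every $S\subseteq X$ the number of edges containing $S$, counted with multiplicity, is at most $\kappa^{-|S|}|\mathcal H|$. Let $\langle\mathcal H\rangle$ be the family of all subsets of $X$ that contain an edge of $\mathcal H$. Theorem. There are a universal constant $K>0$ and a function $\varepsilon:\mathbb N\to\mathbb R$ with $\varepsilon(\ell)\to 0$ as $\ell\to\infty$ such that the following holds. Let $X$ be a finite set, $\ell\in\mathbb N$, $\kappa>0$ real, and $\mathcal H$ an $\ell$-bounded, $\kappa$-spread hypergraph on $X$. Let $m$ be any integer with $$\min\bigl(\lfloor (K\kappa^{-1}\log \ell)\,|X|\rfloor,\ |X|\bigr)\le m\le |X|$$ (with the convention $\log 0=0$). Then a uniformly random $m$-element subset of $X$ belongs to $\langle\mathcal H\rangle$ with probability at least $1-\varepsilon(\ell)$. In particular this applies to sets of size $(K\kappa^{-1}\log\ell)|X|$,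 rounded to an integer in either direction and replaced by $|X|$ if larger than $|X|$. -/

import Mathlib

/-- A hypergraph on the vertex set `X`: a finite collection of subsets of `X` (the edges), with
repeats allowed (Mathlib's `Hypergraph` has a set of edges, hence no repeats). -/
abbrev MultiHypergraph (X : Type*) := Multiset (Finset X)

namespace MultiHypergraph

/-- `⟨H⟩`: the family of all subsets of `X` that contain some edge of `H`. -/
def upFamily {X : Type*} (H : MultiHypergraph X) : Set (Finset X) :=
  {T | ∃ S ∈ H, S ⊆ T}

/-- `H` is `ℓ`-bounded: each edge has size at most `ℓ`. -/
def IsBounded {X : Type*} (H : MultiHypergraph X) (ℓ : ℕ) : Prop :=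
  ∀ S ∈ H, S.card ≤ ℓ

/-- `H` is `κ`-spread: `|H ∩ ⟨S⟩| ≤ κ^{-|S|} |H|` for every `S ⊆ X`, where edges are counted with
multiplicities on both sides. -/
def IsSpread {X : Type*} [DecidableEq X] (H : MultiHypergraph X) (κ : ℝ) : Prop :=
  ∀ S : Finset X,
    ((Multiset.card (H.filter fun T => S ⊆ T) : ℕ) : ℝ)
      ≤ κ⁻¹ ^ S.card * (Multiset.card H : ℝ)

end MultiHypergraph

open Classical in
/-- The probability that a uniformly random `m`-element subset of the finite set `X` belongs to
the family `F` (meaningful for `m ≤ |X|`, when `m`-element subsets exist). -/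
noncomputable def uniformSubsetProb {X : Type*} [Fintype X] (m : ℕ) (F : Set (Finset X)) : ℝ :=
  (((Finset.univ.powersetCard m).filter fun W : Finset X => W ∈ F).card : ℝ)
    / (((Finset.univ : Finset X).powersetCard m).card : ℝ)

open Finset

/-! Spreadness enters only through covers: if every edge contains a member of `𝒰`, then the weight
`∑ κ⁻¹ ^ #U` over `𝒰` is at least 1 (`IsSpread.one_le_sum`).

The random set is exposed in `J = Nat.log 2 ℓ + 1` rounds, indexed from `J - 1` down to 0. After
round `j` exposes `W`, the current edges are replaced by their minimal fragments outside `W`. Those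
with at least `2 ^ j` elements are set aside as part of a cover; the others, of size below `2 ^ j`,
are the edges of the next round. Large fragments cost little on average, because a fragment `T` is a
subset of an edge determined by `W ∪ T` (`card_fragments_le`, `sum_weight_large_fragments_le`).

At the end only the empty edge can survive. If it does not, the fragments set aside cover the
original hypergraph and weigh at least 1. Hence the failure probability is at most the total
expected cost (`mul_card_avoidingSubsets_le`), which the choice of round sizes makes at most `1 /
√J` (`sum_roundError_le`). -/

/-- The inclusion-minimal sets among the traces `S \ W` of the members `S` of `H`. -/
def minimalFragments {α : Type*} [DecidableEq α] (H : Finset (Finset α)) (W : Finset α) :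
    Finset (Finset α) :=
  (H.image (· \ W)).filter fun T => ∀ S ∈ H, S \ W ⊆ T → S \ W = T

/-- The `m`-element subsets of `Y` that contain no member of `H`. -/
def avoidingSubsets {α : Type*} [DecidableEq α] (Y : Finset α) (m : ℕ) (H : Finset (Finset α)) :
    Finset (Finset α) :=
  (Y.powersetCard m).filter fun W => ∀ S ∈ H, ¬ S ⊆ W

/-! ### Minimal fragments and exposure in rounds. -/

section Fragments

variable {α : Type*} [DecidableEq α]

theorem exists_minimalFragments_subset {H : Finset (Finset α)} (W : Finset α) {S : Finset α}
    (hS : S ∈ H) : ∃ T ∈ minimalFragments H W, T ⊆ S := by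
  obtain ⟨T, hTS, hT⟩ := (H.image (· \ W)).exists_le_minimal (mem_image_of_mem (· \ W) hS)
  refine ⟨T, mem_filter.2 ⟨hT.prop, fun S' hS' h => ?_⟩, hTS.trans sdiff_subset⟩
  exact hT.eq_of_le (mem_image_of_mem (· \ W) hS') h

/-- Two-stage sampling of a uniform `m`-element subset, with the first stage of size `w`. -/
theorem sum_avoidingSubsets_two_stage (Y : Finset α) {m w : ℕ} (hw : w ≤ m)
    (H : Finset (Finset α)) :
    ∑ W ∈ Y.powersetCard w, #{V ∈ (Y \ W).powersetCard (m - w) | ∀ S ∈ H, ¬ S ⊆ W ∪ V}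
      = #(avoidingSubsets Y m H) * m.choose w := by
  have h : #(avoidingSubsets Y m H) * m.choose w
      = ∑ Z ∈ avoidingSubsets Y m H, #(Z.powersetCard w) := by
    rw [sum_const_nat]
    intro Z hZ
    rw [card_powersetCard, (mem_powersetCard.1 (mem_filter.1 hZ).1).2]
  rw [h, ← card_sigma, ← card_sigma]
  refine card_bij' (fun x _ => ⟨x.1 ∪ x.2, x.1⟩) (fun x _ => ⟨x.2, x.1 \ x.2⟩) ?_ ?_ ?_ ?_
  · rintro ⟨W, V⟩ hx
    simp only [mem_sigma, mem_powersetCard, mem_filter, avoidingSubsets, subset_sdiff] at hx ⊢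
    obtain ⟨⟨hWY, hWc⟩, ⟨⟨hVY, hVW⟩, hVc⟩, hH⟩ := hx
    refine ⟨⟨⟨union_subset hWY hVY, ?_⟩, hH⟩, subset_union_left, hWc⟩
    rw [card_union_of_disjoint hVW.symm]; omega
  · rintro ⟨Z, W⟩ hx
    simp only [mem_sigma, mem_powersetCard, mem_filter, avoidingSubsets] at hx ⊢
    obtain ⟨⟨⟨hZY, hZc⟩, hH⟩, hWZ, hWc⟩ := hx
    refine ⟨⟨hWZ.trans hZY, hWc⟩, ⟨sdiff_subset_sdiff hZY subset_rfl, ?_⟩, ?_⟩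
    · rw [card_sdiff_of_subset hWZ]; omega
    · rwa [union_sdiff_of_subset hWZ]
  · rintro ⟨W, V⟩ hx
    simp only [mem_sigma, mem_powersetCard, mem_filter, subset_sdiff] at hx
    obtain ⟨-, ⟨⟨-, hVW⟩, -⟩, -⟩ := hx
    simp [union_sdiff_cancel_left hVW.symm]
  · rintro ⟨Z, W⟩ hx
    simp only [mem_sigma, mem_powersetCard] at hx
    simp [union_sdiff_of_subset hx.2.1]

/-- Turns the count of unions `W ∪ T` with `t = #T` into a count of the sets `W`, at a factor `N /
w` per element of `T`. -/
theorem choose_add_mul_pow_le (N w t : ℕ) :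
    N.choose (w + t) * w ^ t ≤ N.choose w * N ^ t := by
  induction t with
  | zero => simp
  | succ t ih =>
    calc N.choose (w + (t + 1)) * w ^ (t + 1)
        = N.choose (w + t + 1) * w * w ^ t := by rw [← add_assoc]; ring
      _ ≤ N.choose (w + t + 1) * (w + t + 1) * w ^ t := by gcongr; omega
      _ = N.choose (w + t) * w ^ t * (N - (w + t)) := by
          rw [Nat.choose_succ_right_eq]; ring
      _ ≤ N.choose w * N ^ t * N := Nat.mul_le_mul ih (Nat.sub_le _ _)
      _ = N.choose w * N ^ (t + 1) := by ring

/-- A minimal fragment `T` with respect to `W` is determined, inside any fixed member of `H`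
contained in `W ∪ T`, as one of its subsets. -/
theorem card_fragments_le {H : Finset (Finset α)} {Y : Finset α} (hY : ∀ S ∈ H, S ⊆ Y) {L : ℕ}
    (hL : ∀ S ∈ H, #S ≤ L) (w t : ℕ) :
    ∑ W ∈ Y.powersetCard w, #{T ∈ minimalFragments H W | #T = t}
      ≤ (#Y).choose (w + t) * L.choose t := by
  classical
  -- The chosen member must depend on `Z = W ∪ T` alone. The default `∅` only keeps the size bound
  -- valid when `Z` contains no member.
  have hex : ∀ Z : Finset α, ∃ R : Finset α, #R ≤ L ∧ ((∃ S ∈ H, S ⊆ Z) → R ∈ H ∧ R ⊆ Z) := by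
    intro Z
    by_cases h : ∃ S ∈ H, S ⊆ Z
    · obtain ⟨S, hS, hSZ⟩ := h
      exact ⟨S, hL S hS, fun _ => ⟨hS, hSZ⟩⟩
    · exact ⟨∅, by simp, fun h' => absurd h' h⟩
  choose R hRL hR using hex
  have hcard : ∑ Z ∈ Y.powersetCard (w + t), #((R Z).powersetCard t)
      ≤ (#Y).choose (w + t) * L.choose t := by
    rw [← card_powersetCard, ← smul_eq_mul]
    refine sum_le_card_nsmul _ _ _ fun Z _ => ?_
    rw [card_powersetCard]
    exact Nat.choose_le_choose t (hRL Z)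
  refine le_trans ?_ hcard
  rw [← card_sigma, ← card_sigma]
  refine card_le_card_of_injOn (fun x => ⟨x.1 ∪ x.2, x.2⟩) ?_ ?_
  · rintro ⟨W, T⟩ hx
    simp only [coe_sigma, Set.mem_sigma_iff, mem_coe, mem_powersetCard, mem_filter,
      minimalFragments, mem_image] at hx ⊢
    obtain ⟨⟨hWY, hWc⟩, ⟨⟨S, hS, rfl⟩, hmin⟩, hT⟩ := hx
    have hR' := hR (W ∪ (S \ W)) ⟨S, hS, by simp⟩
    -- The chosen member leaves a trace inside the fragment, so minimality makes the two equal and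
    -- the fragment lies in that member.
    have hsub : R (W ∪ (S \ W)) \ W ⊆ S \ W := by
      have := sdiff_subset_sdiff hR'.2 (subset_refl W)
      rwa [union_sdiff_cancel_left disjoint_sdiff] at this
    refine ⟨⟨union_subset hWY (sdiff_subset.trans (hY S hS)), ?_⟩, ?_, hT⟩
    · rw [card_union_of_disjoint disjoint_sdiff, hWc, hT]
    · exact (hmin _ hR'.1 hsub).symm.subset.trans sdiff_subset
  · rintro ⟨W, T⟩ hx ⟨W', T'⟩ hx' h
    -- Injectivity: `T` is disjoint from `W`, so `W` is recovered from `W ∪ T` and `T`.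
    have key : ∀ W T, (⟨W, T⟩ : Σ _ : Finset α, Finset α) ∈ ((Y.powersetCard w).sigma
        fun W => {T ∈ minimalFragments H W | #T = t}) → (W ∪ T) \ T = W := by
      intro W T h
      simp only [mem_sigma, mem_filter, minimalFragments, mem_image] at h
      obtain ⟨-, ⟨⟨S, -, rfl⟩, -⟩, -⟩ := h
      exact union_sdiff_cancel_right disjoint_sdiff
    have e1 := key W T (by simpa using hx)
    have e2 := key W' T' (by simpa using hx')
    simp only [Sigma.mk.injEq, heq_eq_eq] at h
    obtain ⟨h1, rfl⟩ := h
    rw [h1, e2] at e1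
    rw [e1]

/-- The average weight of the large minimal fragments is small. -/
theorem sum_weight_large_fragments_le {H : Finset (Finset α)} {Y : Finset α}
    (hY : ∀ S ∈ H, S ⊆ Y) {D : ℕ} (hD : ∀ S ∈ H, #S ≤ 2 * D) {w : ℕ} (hw : 0 < w) {p : ℝ}
    (hp : 0 ≤ p) {n : ℕ} (hn : #Y ≤ n) (hpn : p * n ≤ w) :
    ∑ W ∈ Y.powersetCard w, ∑ T ∈ minimalFragments H W with D ≤ #T, p ^ #T
      ≤ (4 * (p * n / w)) ^ D * (#Y).choose w := by
  have hw' : (0 : ℝ) < w := by exact_mod_cast hw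
  set r : ℝ := p * n / w with hr
  have hr0 : 0 ≤ r := by positivity
  have hr1 : r ≤ 1 := (div_le_one hw').2 hpn
  have hsplit : ∀ W ∈ Y.powersetCard w, ∑ T ∈ minimalFragments H W with D ≤ #T, p ^ #T
      = ∑ t ∈ Icc D (2 * D), (#{T ∈ minimalFragments H W | #T = t} : ℝ) * p ^ t := by
    intro W _
    have hmaps : ∀ T ∈ {T ∈ minimalFragments H W | D ≤ #T}, #T ∈ Icc D (2 * D) := by
      intro T hT
      simp only [mem_filter, minimalFragments, mem_image] at hT
      obtain ⟨⟨⟨S, hS, rfl⟩, -⟩, h⟩ := hT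
      exact mem_Icc.2 ⟨h, (card_le_card sdiff_subset).trans (hD S hS)⟩
    rw [← sum_fiberwise_of_maps_to hmaps]
    refine sum_congr rfl fun t ht => ?_
    have : {T ∈ {T ∈ minimalFragments H W | D ≤ #T} | #T = t}
        = {T ∈ minimalFragments H W | #T = t} := by
      ext T
      simp only [mem_filter]
      constructor
      · rintro ⟨⟨h1, -⟩, h2⟩; exact ⟨h1, h2⟩
      · rintro ⟨h1, h2⟩; exact ⟨⟨h1, h2 ▸ (mem_Icc.1 ht).1⟩, h2⟩
    rw [this, ← nsmul_eq_mul]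
    exact sum_eq_card_nsmul fun T hT => by rw [(mem_filter.1 hT).2]
  rw [sum_congr rfl hsplit, sum_comm]
  have hterm : ∀ t ∈ Icc D (2 * D),
      ∑ W ∈ Y.powersetCard w, (#{T ∈ minimalFragments H W | #T = t} : ℝ) * p ^ t
        ≤ r ^ D * (#Y).choose w * (2 * D).choose t := by
    intro t ht
    rw [← sum_mul, ← Nat.cast_sum]
    have h1 : ((∑ W ∈ Y.powersetCard w, #{T ∈ minimalFragments H W | #T = t} : ℕ) : ℝ)
        ≤ (#Y).choose (w + t) * (2 * D).choose t := by
      exact_mod_cast card_fragments_le hY hD w t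
    have h2 : ((#Y).choose (w + t) : ℝ) * (w : ℝ) ^ t ≤ (#Y).choose w * (n : ℝ) ^ t := by
      exact_mod_cast (choose_add_mul_pow_le _ w t).trans (by gcongr)
    have h3 : ((#Y).choose (w + t) : ℝ) * p ^ t ≤ (#Y).choose w * r ^ t := by
      rw [hr, div_pow, mul_pow, ← mul_div_assoc, le_div_iff₀ (by positivity)]
      calc ((#Y).choose (w + t) : ℝ) * p ^ t * (w : ℝ) ^ t
          = ((#Y).choose (w + t) : ℝ) * (w : ℝ) ^ t * p ^ t := by ring
        _ ≤ (#Y).choose w * (n : ℝ) ^ t * p ^ t := by gcongr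
        _ = _ := by ring
    calc _ ≤ ((#Y).choose (w + t) * (2 * D).choose t : ℝ) * p ^ t := by gcongr
      _ = ((#Y).choose (w + t) * p ^ t) * (2 * D).choose t := by ring
      _ ≤ ((#Y).choose w * r ^ t) * (2 * D).choose t := by gcongr
      _ ≤ ((#Y).choose w * r ^ D) * (2 * D).choose t := by
        have := pow_le_pow_of_le_one hr0 hr1 (mem_Icc.1 ht).1
        gcongr
      _ = _ := by ring
  refine (sum_le_sum hterm).trans ?_
  rw [← mul_sum]
  -- The source of the factor 4: a set of size `2 * D` has `4 ^ D` subsets.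
  have hsum : ∑ t ∈ Icc D (2 * D), ((2 * D).choose t : ℝ) ≤ 4 ^ D := by
    have h1 : ∑ t ∈ Icc D (2 * D), (2 * D).choose t ≤ ∑ t ∈ range (2 * D + 1), (2 * D).choose t :=
      sum_le_sum_of_subset fun t ht => mem_range.2 (by have := (mem_Icc.1 ht).2; omega)
    rw [Nat.sum_range_choose, pow_mul] at h1
    exact_mod_cast h1
  calc r ^ D * (#Y).choose w * ∑ t ∈ Icc D (2 * D), ((2 * D).choose t : ℝ)
      ≤ r ^ D * (#Y).choose w * 4 ^ D := by gcongr
    _ = _ := by rw [mul_pow]; ring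

/-- One round of exposure: passing from `H` to the small minimal fragments. -/
theorem mul_card_avoidingSubsets_le_of_fragments {H : Finset (Finset α)} {Y W : Finset α} {k : ℕ}
    {D : ℕ} {p c e : ℝ} (hp : 0 ≤ p) (he : 0 ≤ e)
    (hc : ∀ 𝒰 : Finset (Finset α), (∀ S ∈ H, ∃ U ∈ 𝒰, U ⊆ S) → c ≤ ∑ U ∈ 𝒰, p ^ #U)
    (ih : ∀ c' : ℝ, (∀ 𝒰 : Finset (Finset α),
        (∀ S ∈ {T ∈ minimalFragments H W | #T < D}, ∃ U ∈ 𝒰, U ⊆ S) → c' ≤ ∑ U ∈ 𝒰, p ^ #U) →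
      c' * #(avoidingSubsets Y k {T ∈ minimalFragments H W | #T < D}) ≤ e * (#Y).choose k) :
    c * #{V ∈ Y.powersetCard k | ∀ S ∈ H, ¬ S ⊆ W ∪ V}
      ≤ ((∑ T ∈ minimalFragments H W with D ≤ #T, p ^ #T) + e) * (#Y).choose k := by
  set q : ℝ := ∑ T ∈ minimalFragments H W with D ≤ #T, p ^ #T with hq
  have hq0 : 0 ≤ q := sum_nonneg fun T _ => by positivity
  have hle : (#{V ∈ Y.powersetCard k | ∀ S ∈ H, ¬ S ⊆ W ∪ V} : ℝ) ≤ (#Y).choose k := by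
    rw [← card_powersetCard]
    exact_mod_cast card_filter_le _ _
  have hsub : (#{V ∈ Y.powersetCard k | ∀ S ∈ H, ¬ S ⊆ W ∪ V} : ℝ)
      ≤ #(avoidingSubsets Y k {T ∈ minimalFragments H W | #T < D}) := by
    norm_cast
    refine card_le_card fun V hV => ?_
    simp only [avoidingSubsets, mem_filter] at hV ⊢
    refine ⟨hV.1, fun T hT hTV => ?_⟩
    simp only [minimalFragments, mem_filter, mem_image] at hT
    obtain ⟨⟨⟨S, hS, rfl⟩, -⟩, -⟩ := hT
    exact hV.2 S hS (sdiff_le_iff.1 hTV)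
  -- A cover of the small fragments together with all the large ones covers `H`, so it loses at most
  -- `q` of the weight `c`.
  have hih := ih (c - q) fun 𝒰 h𝒰 => by
    have := hc (𝒰 ∪ {T ∈ minimalFragments H W | D ≤ #T}) fun S hS => by
      obtain ⟨T, hT, hTS⟩ := exists_minimalFragments_subset W hS
      by_cases hTD : D ≤ #T
      · exact ⟨T, mem_union_right _ (mem_filter.2 ⟨hT, hTD⟩), hTS⟩
      · obtain ⟨U, hU, hUT⟩ := h𝒰 T (mem_filter.2 ⟨hT, not_le.1 hTD⟩)
        exact ⟨U, mem_union_left _ hU, hUT.trans hTS⟩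
    have h2 : ∑ U ∈ 𝒰 ∪ {T ∈ minimalFragments H W | D ≤ #T}, p ^ #U
        ≤ ∑ U ∈ 𝒰, p ^ #U + q := by
      rw [hq, ← sum_union_inter]
      exact le_add_of_nonneg_right (sum_nonneg fun T _ => by positivity)
    linarith
  set b : ℝ := (#{V ∈ Y.powersetCard k | ∀ S ∈ H, ¬ S ⊆ W ∪ V} : ℝ)
  have hb0 : 0 ≤ b := Nat.cast_nonneg _
  have h1 : (c - q) * b ≤ e * (#Y).choose k := by
    -- When `q` exceeds `c` the left side is nonpositive and nothing is needed from the next round.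
    rcases le_total 0 (c - q) with h | h
    · exact (mul_le_mul_of_nonneg_left hsub h).trans hih
    · exact (mul_nonpos_of_nonpos_of_nonneg h hb0).trans (by positivity)
  have h2 : q * b ≤ q * (#Y).choose k := mul_le_mul_of_nonneg_left hle hq0
  linarith

/-- If every cover of `H` has weight at least `c`, all members of `H` have fewer than `2 ^ J`
elements, and `m` is at least the sum of the sizes `w j` of `J` rounds of exposure, then few
`m`-element subsets contain no member of `H`. -/
theorem mul_card_avoidingSubsets_le {p : ℝ} (hp : 0 ≤ p) {n : ℕ} (w : ℕ → ℕ)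
    (hw : ∀ j, 0 < w j) (hpw : ∀ j, p * n ≤ w j) (J : ℕ) {m : ℕ} {Y : Finset α} (hn : #Y ≤ n)
    (hm : ∑ j ∈ range J, w j ≤ m) (hmY : m ≤ #Y) {H : Finset (Finset α)} (hY : ∀ S ∈ H, S ⊆ Y)
    (hJ : ∀ S ∈ H, #S < 2 ^ J) {c : ℝ}
    (hc : ∀ 𝒰 : Finset (Finset α), (∀ S ∈ H, ∃ U ∈ 𝒰, U ⊆ S) → c ≤ ∑ U ∈ 𝒰, p ^ #U) :
    c * #(avoidingSubsets Y m H)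
      ≤ (∑ j ∈ range J, (4 * (p * n / w j)) ^ 2 ^ j) * (#Y).choose m := by
  induction J generalizing m Y H c with
  | zero =>
    simp only [range_zero, sum_empty, zero_mul]
    -- All members are empty here: either there are none and the empty cover forces `c ≤ 0`, or `∅`
    -- is a member and no set avoids `H`.
    rcases H.eq_empty_or_nonempty with rfl | ⟨S, hS⟩
    · have : c ≤ 0 := by simpa using hc ∅ (by simp)
      exact mul_nonpos_of_nonpos_of_nonneg this (Nat.cast_nonneg _)
    · have hS0 : S = ∅ := by simpa using hJ S hS
      have : avoidingSubsets Y m H = ∅ :=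
        filter_eq_empty_iff.2 fun W _ h => h S hS (by simp [hS0])
      simp [this]
  | succ J ih =>
    rw [sum_range_succ] at hm ⊢
    set e : ℝ := ∑ j ∈ range J, (4 * (p * n / w j)) ^ 2 ^ j with he
    have he0 : 0 ≤ e := sum_nonneg fun j _ => by positivity
    have hwm : w J ≤ m := by omega
    have hround : ∀ W ∈ Y.powersetCard (w J),
        c * #{V ∈ (Y \ W).powersetCard (m - w J) | ∀ S ∈ H, ¬ S ⊆ W ∪ V}
          ≤ ((∑ T ∈ minimalFragments H W with 2 ^ J ≤ #T, p ^ #T) + e)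
            * (#Y - w J).choose (m - w J) := by
      intro W hW
      obtain ⟨hWY, hWc⟩ := mem_powersetCard.1 hW
      have hcard : #(Y \ W) = #Y - w J := by rw [card_sdiff_of_subset hWY, hWc]
      rw [← hcard]
      refine mul_card_avoidingSubsets_le_of_fragments hp he0 hc fun c' hc' => ?_
      -- The ground set shrinks to `Y \ W` while `n` stays fixed, which is why `n` only bounds `#Y`
      -- from above.
      refine ih (by omega) (by omega) (by omega) ?_ (fun T hT => (mem_filter.1 hT).2) hc'
      intro T hT
      simp only [minimalFragments, mem_filter, mem_image] at hT
      obtain ⟨⟨⟨S, hS, rfl⟩, -⟩, -⟩ := hT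
      exact sdiff_subset_sdiff (hY S hS) subset_rfl
    -- The bound for each `W` is linear in its cost, so it can be averaged directly, with no Markov
    -- inequality losing a constant in each round.
    have hsum := sum_le_sum hround
    rw [← mul_sum, ← Nat.cast_sum, sum_avoidingSubsets_two_stage Y hwm, ← sum_mul,
      sum_add_distrib, sum_const, card_powersetCard, nsmul_eq_mul] at hsum
    have hcost := sum_weight_large_fragments_le hY (D := 2 ^ J)
      (fun S hS => by have := hJ S hS; rw [pow_succ] at this; omega) (hw J) hp hn (hpw J)
    have hmul : ((#Y).choose m : ℝ) * m.choose (w J)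
        = (#Y).choose (w J) * (#Y - w J).choose (m - w J) := by
      exact_mod_cast Nat.choose_mul hwm
    have hpos : (0 : ℝ) < m.choose (w J) := by exact_mod_cast Nat.choose_pos hwm
    refine le_of_mul_le_mul_right ?_ hpos
    push_cast at hsum
    calc c * #(avoidingSubsets Y m H) * m.choose (w J)
        = c * (#(avoidingSubsets Y m H) * m.choose (w J)) := by ring
      _ ≤ _ := hsum
      _ ≤ ((4 * (p * n / w J)) ^ 2 ^ J * (#Y).choose (w J) + (#Y).choose (w J) * e)
            * (#Y - w J).choose (m - w J) := by gcongr
      _ = (e + (4 * (p * n / w J)) ^ 2 ^ J)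
            * ((#Y).choose (w J) * (#Y - w J).choose (m - w J)) := by ring
      _ = _ := by rw [← hmul]; ring

end Fragments

/-! ### Choice of the round sizes. -/

section RoundSizes

/-- By telescoping `2 * √j`. This crude harmonic bound suffices: with `A = √J` the extra terms `A /
(j + 1)` of the round sizes sum to `O(J)`. -/
theorem sum_range_inv_succ_le (J : ℕ) :
    ∑ j ∈ range J, ((j : ℝ) + 1)⁻¹ ≤ 2 * √J := by
  induction J with
  | zero => simp
  | succ J ih =>
    rw [sum_range_succ]
    have h1 : (0 : ℝ) < (J : ℝ) + 1 := by positivity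
    have hs := Real.sq_sqrt h1.le
    have hs' := Real.sq_sqrt (Nat.cast_nonneg (α := ℝ) J)
    have hle : √(J : ℝ) ≤ √((J : ℝ) + 1) := Real.sqrt_le_sqrt (by linarith)
    have hone : 1 ≤ √((J : ℝ) + 1) := Real.one_le_sqrt.2 (by simp)
    have h0 := Real.sqrt_nonneg (J : ℝ)
    have key : ((J : ℝ) + 1)⁻¹ ≤ 2 * √((J : ℝ) + 1) - 2 * √J := by
      rw [inv_le_iff_one_le_mul₀ h1]
      set a := √((J : ℝ) + 1)
      set b := √(J : ℝ)
      rw [← hs]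
      have hab : (a - b) * (a + b) = 1 := by ring_nf; linarith
      have : 0 ≤ a - b := by linarith
      nlinarith [mul_nonneg this (sub_nonneg.2 hle), mul_nonneg this (sub_nonneg.2 hone),
        mul_nonneg (mul_nonneg this (sub_nonneg.2 hone)) (h0.trans hle)]
    push_cast
    linarith

/-- The size of the `j`-th round of exposure; `x` is the expected size of a random set. -/
noncomputable def roundSize (x A : ℝ) (j : ℕ) : ℕ := ⌈8 * (1 + A / (j + 1)) * x⌉₊

theorem mul_le_roundSize (x A : ℝ) (j : ℕ) : 8 * (1 + A / (j + 1)) * x ≤ roundSize x A j :=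
  Nat.le_ceil _

theorem le_roundSize {x A : ℝ} (hx : 0 ≤ x) (hA : 0 ≤ A) (j : ℕ) : x ≤ roundSize x A j := by
  refine le_trans ?_ (mul_le_roundSize x A j)
  have : 0 ≤ A / ((j : ℝ) + 1) := by positivity
  nlinarith

theorem sum_roundSize_le {x : ℝ} (hx : 1 ≤ x) (J : ℕ) :
    ((∑ j ∈ range J, roundSize x (√J) j : ℕ) : ℝ) ≤ 25 * J * x := by
  push_cast
  -- Since `x ≥ 1`, the rounding up costs at most one more `x`, turning 8 into 9.
  have h : ∀ j ∈ range J, (roundSize x (√J) j : ℝ) ≤ 9 * x + 8 * x * √J * ((j : ℝ) + 1)⁻¹ := by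
    intro j _
    have h0 : 0 ≤ √(J : ℝ) / ((j : ℝ) + 1) := by positivity
    have := (Nat.ceil_lt_add_one (a := 8 * (1 + √(J : ℝ) / (j + 1)) * x) (by positivity)).le
    rw [roundSize]
    refine this.trans ?_
    rw [div_eq_mul_inv]
    linarith
  refine (sum_le_sum h).trans ?_
  rw [sum_add_distrib, sum_const, card_range, nsmul_eq_mul, ← mul_sum]
  have h2 : 8 * x * √J * ∑ j ∈ range J, ((j : ℝ) + 1)⁻¹ ≤ 8 * x * √J * (2 * √J) := by
    gcongr
    exact sum_range_inv_succ_le J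
  have hs := Real.mul_self_sqrt (Nat.cast_nonneg (α := ℝ) J)
  calc _ ≤ J * (9 * x) + 8 * x * √J * (2 * √J) := by linarith
    _ = J * (9 * x) + 16 * x * (√J * √J) := by ring
    _ = 25 * J * x := by rw [hs]; ring

/-- The factor 8 in `roundSize` leaves `1 / (2 * y)` with `y = 1 + A / (j + 1)`. As `2 ^ j ≥ j + 1`,
the power yields a geometric factor and, by Bernoulli's inequality `y ^ (j + 1) ≥ A`, a gain of
`A⁻¹`. -/
theorem roundError_le {x A : ℝ} (hx : 0 < x) (hA : 0 < A) (j : ℕ) :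
    (4 * (x / roundSize x A j)) ^ 2 ^ j ≤ (1 / 2) ^ (j + 1) * A⁻¹ := by
  have hj : (0 : ℝ) < (j : ℝ) + 1 := by positivity
  set y : ℝ := 1 + A / (j + 1) with hy
  have hy1 : 1 ≤ y := by have : 0 ≤ A / ((j : ℝ) + 1) := by positivity
                         linarith
  have hy0 : 0 < y := by linarith
  have h1 : 4 * (x / roundSize x A j) ≤ 1 / 2 * y⁻¹ := by
    calc 4 * (x / roundSize x A j) ≤ 4 * (x / (8 * y * x)) := by
          gcongr
          exact mul_le_roundSize x A j
      _ = 1 / 2 * y⁻¹ := by field_simp; norm_num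
  have h2 : 1 / 2 * y⁻¹ ≤ 1 := by
    have := inv_le_one_of_one_le₀ hy1
    linarith
  have h3 : A ≤ y ^ (j + 1) := by
    have := one_add_mul_le_pow (a := A / ((j : ℝ) + 1)) (by
      have : 0 ≤ A / ((j : ℝ) + 1) := by positivity
      linarith) (j + 1)
    push_cast at this
    rw [mul_div_cancel₀ _ hj.ne'] at this
    linarith
  calc (4 * (x / roundSize x A j)) ^ 2 ^ j ≤ (1 / 2 * y⁻¹) ^ 2 ^ j := by gcongr
    _ ≤ (1 / 2 * y⁻¹) ^ (j + 1) :=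
        pow_le_pow_of_le_one (by positivity) h2 (Nat.succ_le_of_lt Nat.lt_two_pow_self)
    _ = (1 / 2) ^ (j + 1) * (y ^ (j + 1))⁻¹ := by rw [mul_pow, inv_pow]
    _ ≤ _ := by gcongr

theorem sum_roundError_le {x A : ℝ} (hx : 0 < x) (hA : 0 < A) (J : ℕ) :
    ∑ j ∈ range J, (4 * (x / roundSize x A j)) ^ 2 ^ j ≤ A⁻¹ := by
  refine (sum_le_sum fun j _ => roundError_le hx hA j).trans ?_
  rw [← sum_mul]
  have h : ∑ j ∈ range J, (1 / 2 : ℝ) ^ (j + 1) = 1 - (1 / 2) ^ J := by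
    induction J with
    | zero => simp
    | succ J ih => rw [sum_range_succ, ih]; ring
  have h' : (0 : ℝ) ≤ (1 / 2) ^ J := by positivity
  rw [h]
  exact mul_le_of_le_one_left (by positivity) (by linarith)

end RoundSizes

/-! ### Covers of spread hypergraphs. -/

namespace MultiHypergraph

variable {X : Type*} [DecidableEq X]

/-- Each edge is counted, with multiplicity, at some member of the cover that it contains. -/
theorem card_le_sum_of_cover (H : MultiHypergraph X) (𝒰 : Finset (Finset X))
    (h : ∀ S ∈ H, ∃ U ∈ 𝒰, U ⊆ S) :
    Multiset.card H ≤ ∑ U ∈ 𝒰, Multiset.card (H.filter fun T => U ⊆ T) := by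
  induction H using Multiset.induction_on with
  | empty => simp
  | cons S H ih =>
    obtain ⟨U, hU, hUS⟩ := h S (Multiset.mem_cons_self S H)
    rw [Multiset.card_cons]
    refine (Nat.succ_le_succ (ih fun T hT => h T (Multiset.mem_cons_of_mem hT))).trans ?_
    refine Nat.succ_le_of_lt (sum_lt_sum (fun V _ => ?_) ⟨U, hU, ?_⟩)
    · exact Multiset.card_le_card (Multiset.filter_le_filter _ (Multiset.le_cons_self H S))
    · rw [Multiset.filter_cons_of_pos _ hUS, Multiset.card_cons]
      exact Nat.lt_succ_self _

/-- Every cover of a `κ`-spread hypergraph has weight at least `1`. -/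
theorem IsSpread.one_le_sum {H : MultiHypergraph X} {κ : ℝ} (hH : H ≠ 0) (hs : H.IsSpread κ)
    (𝒰 : Finset (Finset X)) (h : ∀ S ∈ H, ∃ U ∈ 𝒰, U ⊆ S) :
    1 ≤ ∑ U ∈ 𝒰, κ⁻¹ ^ #U := by
  have hpos : (0 : ℝ) < Multiset.card H := by exact_mod_cast Multiset.card_pos.2 hH
  refine le_of_mul_le_mul_right ?_ hpos
  calc 1 * (Multiset.card H : ℝ)
      ≤ ∑ U ∈ 𝒰, ((Multiset.card (H.filter fun T => U ⊆ T) : ℕ) : ℝ) := by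
        rw [one_mul]; exact_mod_cast card_le_sum_of_cover H 𝒰 h
    _ ≤ ∑ U ∈ 𝒰, κ⁻¹ ^ #U * (Multiset.card H : ℝ) := sum_le_sum fun U _ => hs U
    _ = _ := by rw [sum_mul]

/-- The singletons cover any hypergraph without an empty edge. This gives the `x ≥ 1` that absorbs
the rounding in `sum_roundSize_le`. -/
theorem IsSpread.one_le_inv_mul_card [Fintype X] {H : MultiHypergraph X} {κ : ℝ} (hH : H ≠ 0)
    (hs : H.IsSpread κ) (h0 : ∅ ∉ H) : 1 ≤ κ⁻¹ * Fintype.card X := by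
  have := hs.one_le_sum hH (univ.map ⟨fun x => {x}, singleton_injective⟩) fun S hS => by
    obtain ⟨x, hx⟩ := nonempty_iff_ne_empty.2 fun h : S = ∅ => h0 (h ▸ hS)
    exact ⟨{x}, by simp, by simpa using hx⟩
  rw [sum_map] at this
  simpa [mul_comm] using this

end MultiHypergraph

/-! ### Uniform random subsets and the main theorem. -/

theorem uniformSubsetProb_nonneg {X : Type*} [Fintype X] (m : ℕ) (F : Set (Finset X)) :
    0 ≤ uniformSubsetProb m F := by
  unfold uniformSubsetProb; positivity

theorem uniformSubsetProb_eq_one {X : Type*} [Fintype X] {m : ℕ} (hm : m ≤ Fintype.card X)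
    {F : Set (Finset X)} (h : ∀ W : Finset X, #W = m → W ∈ F) : uniformSubsetProb m F = 1 := by
  classical
  unfold uniformSubsetProb
  rw [filter_true_of_mem fun W hW => h W (mem_powersetCard.1 hW).2]
  refine div_self ?_
  rw [card_powersetCard, card_univ]
  exact_mod_cast (Nat.choose_pos hm).ne'

theorem uniformSubsetProb_upFamily {X : Type*} [Fintype X] [DecidableEq X] {m : ℕ}
    (hm : m ≤ Fintype.card X) (H : MultiHypergraph X) :
    uniformSubsetProb m H.upFamily
      = 1 - #(avoidingSubsets univ m H.toFinset) / ((Fintype.card X).choose m : ℝ) := by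
  classical
  have hpos : (0 : ℝ) < (Fintype.card X).choose m := by exact_mod_cast Nat.choose_pos hm
  have h := card_filter_add_card_filter_not (s := (univ : Finset X).powersetCard m)
    fun W => W ∈ H.upFamily
  have heq : {W ∈ (univ : Finset X).powersetCard m | W ∉ H.upFamily}
      = avoidingSubsets univ m H.toFinset := by
    ext W
    simp [avoidingSubsets, MultiHypergraph.upFamily]
  rw [heq, card_powersetCard, card_univ] at h
  rw [eq_sub_iff_add_eq, uniformSubsetProb, card_powersetCard, card_univ, ← add_div,
    div_eq_one_iff_eq hpos.ne']
  rw [← h]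
  push_cast
  congr!

theorem natLog_two_add_one_le {ℓ : ℕ} (hℓ : 2 ≤ ℓ) :
    ((Nat.log 2 ℓ + 1 : ℕ) : ℝ) ≤ 4 * Real.log ℓ := by
  have h1 : 1 ≤ Nat.log 2 ℓ := Nat.log_pos (by norm_num) hℓ
  have h2 : (Nat.log 2 ℓ : ℝ) * Real.log 2 ≤ Real.log ℓ := by
    rw [← Real.log_pow]
    refine Real.log_le_log (by positivity) ?_
    exact_mod_cast Nat.pow_log_le_self 2 (by omega)
  have h3 : (1 : ℝ) ≤ Nat.log 2 ℓ := by exact_mod_cast h1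
  have h4 := Real.log_two_gt_d9
  push_cast
  nlinarith

theorem theorem1p6 :
    ∃ K : ℝ, 0 < K ∧ ∃ ε : ℕ → ℝ, Filter.Tendsto ε Filter.atTop (nhds 0) ∧
      ∀ (X : Type*) [Fintype X] [DecidableEq X] (ℓ : ℕ) (κ : ℝ) (H : MultiHypergraph X) (m : ℕ),
        0 < κ → H ≠ 0 → H.IsBounded ℓ → H.IsSpread κ →
        min ⌊K * κ⁻¹ * Real.log (ℓ : ℝ) * (Fintype.card X : ℝ)⌋₊ (Fintype.card X) ≤ m →
        m ≤ Fintype.card X →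
        1 - ε ℓ ≤ uniformSubsetProb m H.upFamily := by
  -- `100 = 25 * 4`: the rounds use at most `25 * J * x` elements, and `J ≤ 4 * Real.log ℓ`.
  refine ⟨100, by norm_num, fun ℓ => (√((Nat.log 2 ℓ + 1 : ℕ) : ℝ))⁻¹, ?_, ?_⟩
  · refine Filter.Tendsto.inv_tendsto_atTop (Real.tendsto_sqrt_atTop.comp
      (tendsto_natCast_atTop_atTop.comp ?_))
    refine Filter.tendsto_atTop.2 fun b => Filter.eventually_atTop.2 ⟨2 ^ b, fun ℓ hℓ => ?_⟩
    exact (Nat.le_log_of_pow_le (by norm_num) hℓ).trans (Nat.le_succ _)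
  intro X _ _ ℓ κ H m hκ hH hb hs hmin hm
  have hε : (0 : ℝ) ≤ (√((Nat.log 2 ℓ + 1 : ℕ) : ℝ))⁻¹ := by positivity
  -- For `ℓ < 2` the error term is exactly 1.
  rcases lt_or_ge ℓ 2 with hℓ | hℓ
  · have : Nat.log 2 ℓ = 0 := Nat.log_of_lt hℓ
    simpa [this] using uniformSubsetProb_nonneg m H.upFamily
  -- Once `m < |X|`, the minimum in `hmin` must be the floor.
  by_cases hmX : m = Fintype.card X
  · rw [uniformSubsetProb_eq_one hm fun W hW => ?_]
    · linarith
    · obtain ⟨S, hS⟩ := Multiset.exists_mem_of_ne_zero hH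
      exact ⟨S, hS, ((card_eq_iff_eq_univ W).1 (hW.trans hmX)) ▸ subset_univ S⟩
  by_cases h0 : ∅ ∈ H
  · have h : ∀ W : Finset X, #W = m → W ∈ H.upFamily := fun W _ => ⟨∅, h0, empty_subset W⟩
    rw [uniformSubsetProb_eq_one hm h]
    linarith
  have hx := hs.one_le_inv_mul_card hH h0
  set J := Nat.log 2 ℓ + 1 with hJ
  set n := Fintype.card X with hn
  have hJ0 : (0 : ℝ) < √(J : ℝ) := Real.sqrt_pos.2 (by rw [hJ]; positivity)
  have hJm : ∑ j ∈ range J, roundSize (κ⁻¹ * n) (√J) j ≤ m := by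
    have hfloor : ⌊100 * κ⁻¹ * Real.log ℓ * (n : ℝ)⌋₊ ≤ m := by
      rcases min_le_iff.1 hmin with h | h
      · exact h
      · omega
    refine le_trans (Nat.le_floor ((sum_roundSize_le hx J).trans ?_)) hfloor
    have := natLog_two_add_one_le hℓ
    calc 25 * (J : ℝ) * (κ⁻¹ * n) ≤ 25 * (4 * Real.log ℓ) * (κ⁻¹ * n) := by gcongr
      _ = _ := by ring
  have hle : ∀ j, κ⁻¹ * n ≤ roundSize (κ⁻¹ * n) (√J) j :=
    le_roundSize (by linarith) (Real.sqrt_nonneg _)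
  have main := mul_card_avoidingSubsets_le (p := κ⁻¹) (by positivity) (n := n)
    (roundSize (κ⁻¹ * n) (√J))
    (fun j => by exact_mod_cast (by linarith : (0 : ℝ) < κ⁻¹ * n).trans_le (hle j)) hle J
    (Y := (univ : Finset X)) le_rfl hJm hm (H := H.toFinset) (fun S _ => subset_univ S)
    (fun S hS => (hb S (Multiset.mem_toFinset.1 hS)).trans_lt
      (Nat.lt_pow_succ_log_self (by norm_num) ℓ))
    (c := 1) fun 𝒰 h𝒰 => hs.one_le_sum hH 𝒰 fun S hS => h𝒰 S (Multiset.mem_toFinset.2 hS)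
  rw [uniformSubsetProb_upFamily hm]
  have hpos : (0 : ℝ) < n.choose m := by exact_mod_cast Nat.choose_pos hm
  refine sub_le_sub_left ((div_le_iff₀ hpos).2 ?_) 1
  rw [one_mul, card_univ] at main
  refine main.trans ?_
  gcongr
  exact sum_roundError_le (by linarith) hJ0 J
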